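/- Conventions. A real interval is a nonempty compact interval $[a,b]$, $a\le b$; sums, differences and products of real intervals are the sets of all sums, differences, products of their elements. A complex interval is a set $A+Bi=\{s+ti: s\in A,\ t\in B\}$ with $A,B$ real intervals; complex intervals are added and subtracted by real and imaginary parts and multiplied by $$(A+Bi)(C+Di)=(AC-BD)+(AD+BC)i .$$ A complex number is identified with the degenerate complex interval containing it. A box in $\mathbb{C}^n$ is an $n$-fold product of complex intervals, and an $n\times n$ interval matrix is an $n\times n$ array of complex intervals, regarded also as the set of complex matrices whose entries lie in the corresponding intervals. Sums, differences and products of interval matrices and boxes are computed entrywise by the usual formulas with this interval arithmetic. For $U\subseteq\mathbb{C}^n$, let $\mathbb{I}U$ be the set of boxes contained in $U$. **Theorem (Krawczyk test over $\mathbb{C}$).** Let $U\subseteq\mathbb{C}^n$ be open, let $F:U\to\mathbb{C}^n$ be (complex) differentiable with Jacobian matrix $F'$, and let $\square F'$ be an interval extension of $F'$, i.e. a map assigning to each $J\in\mathbb{I}U$ an $n\times n$ interval matrix $\square F'(J)$ with $F'(x)\in\square F'(J)$ for all $x\in J$. Let $I\in\mathbb{I}U$, $y\in I$, let $Y\in GL_n(\mathbb{C})$,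 let $I_n$ be the $n\times n$ identity matrix, and put $$K_y(I):=y-YF(y)+\bigl(I_n-Y\,\square F'(I)\bigr)(I-y).$$ Then: 1. If $x\in I$ is a root of $F$, then $x\in K_y(I)$. 2. If $K_y(I)\subseteq I$, then $F$ has a root in $I$. 3. If $I$ contains a root of $F$ and $\sqrt2\,\|I_n-Y\square F'(I)\|<1$, then the root of $F$ in $I$ is unique. Here $\|I_n-Y\square F'(I)\|$ is the maximum, over all complex matrices in the interval matrix $I_n-Y\square F'(I)$, of the operator norm with respect to the max-norm on $\mathbb{C}^n$. -/

import Mathlib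

namespace Krawczyk

noncomputable section

/-- The interval product `[a, b][c, d] = {x * y : x ∈ [a, b], y ∈ [c, d]}` of two nonempty compact
real intervals, given by its end points; `coe_realMul` identifies it with the set of products.
(Sums and differences of real intervals are Mathlib's `+` and `-` on `NonemptyInterval ℝ`.) -/
def realMul (s t : NonemptyInterval ℝ) : NonemptyInterval ℝ where
  fst := min (min (s.fst * t.fst) (s.fst * t.snd)) (min (s.snd * t.fst) (s.snd * t.snd))
  snd := max (max (s.fst * t.fst) (s.fst * t.snd)) (max (s.snd * t.fst) (s.snd * t.snd))
  fst_le_snd := ((min_le_left _ _).trans (min_le_left _ _)).trans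
    ((le_max_left _ _).trans (le_max_left _ _))

theorem mul_mem_realMul {s t : NonemptyInterval ℝ} {x y : ℝ} (hx : x ∈ s) (hy : y ∈ t) :
    x * y ∈ realMul s t := by
  rw [NonemptyInterval.mem_def] at hx hy ⊢
  obtain ⟨hx1, hx2⟩ := hx
  obtain ⟨hy1, hy2⟩ := hy
  simp only [realMul, min_le_iff, le_max_iff]
  constructor
  · rcases le_total 0 y with h | h
    · rcases le_total 0 s.fst with h' | h'
      · left; left; nlinarith
      · left; right; nlinarith
    · rcases le_total 0 s.snd with h' | h'
      · right; left; nlinarith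
      · right; right; nlinarith
  · rcases le_total 0 y with h | h
    · rcases le_total 0 s.snd with h' | h'
      · right; right; nlinarith
      · right; left; nlinarith
    · rcases le_total 0 s.fst with h' | h'
      · left; right; nlinarith
      · left; left; nlinarith

theorem coe_realMul (s t : NonemptyInterval ℝ) :
    (realMul s t : Set ℝ) = Set.image2 (fun x y : ℝ => x * y) s t := by
  apply Set.Subset.antisymm
  · have hc : IsPreconnected (Set.image2 (fun x y : ℝ => x * y) (s : Set ℝ) (t : Set ℝ)) := by
      rw [← Set.image_prod]
      refine IsPreconnected.image ?_ _ (by fun_prop)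
      exact IsPreconnected.prod (by rw [NonemptyInterval.coe_def]; exact isPreconnected_Icc)
        (by rw [NonemptyInterval.coe_def]; exact isPreconnected_Icc)
    have h1 : s.fst ∈ (s : Set ℝ) := ⟨le_refl _, s.fst_le_snd⟩
    have h2 : s.snd ∈ (s : Set ℝ) := ⟨s.fst_le_snd, le_refl _⟩
    have h3 : t.fst ∈ (t : Set ℝ) := ⟨le_refl _, t.fst_le_snd⟩
    have h4 : t.snd ∈ (t : Set ℝ) := ⟨t.fst_le_snd, le_refl _⟩
    have e1 := Set.mem_image2_of_mem (f := fun x y : ℝ => x * y) h1 h3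
    have e2 := Set.mem_image2_of_mem (f := fun x y : ℝ => x * y) h1 h4
    have e3 := Set.mem_image2_of_mem (f := fun x y : ℝ => x * y) h2 h3
    have e4 := Set.mem_image2_of_mem (f := fun x y : ℝ => x * y) h2 h4
    rw [NonemptyInterval.coe_def]
    refine hc.Icc_subset ?_ ?_
    · exact min_rec' _ (min_rec' _ e1 e2) (min_rec' _ e3 e4)
    · exact max_rec' _ (max_rec' _ e1 e2) (max_rec' _ e3 e4)
  · rintro _ ⟨x, hx, y, hy, rfl⟩
    exact mul_mem_realMul hx hy

/-- A complex interval `[a₁, a₂] + [b₁, b₂] i`. -/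
@[ext]
structure ComplexInterval where
  re : NonemptyInterval ℝ
  im : NonemptyInterval ℝ

namespace ComplexInterval

instance : Membership ℂ ComplexInterval := ⟨fun S z => z.re ∈ S.re ∧ z.im ∈ S.im⟩

/-- The degenerate interval `{z}`. -/
def point (z : ℂ) : ComplexInterval := ⟨NonemptyInterval.pure z.re, NonemptyInterval.pure z.im⟩

instance : Zero ComplexInterval := ⟨point 0⟩

instance : Add ComplexInterval := ⟨fun S T => ⟨S.re + T.re, S.im + T.im⟩⟩

instance : Sub ComplexInterval := ⟨fun S T => ⟨S.re - T.re, S.im - T.im⟩⟩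

/-- Complex interval multiplication: `(A + B i)(C + D i) = (A C - B D) + (A D + B C) i`, computed
with real interval arithmetic. -/
instance : Mul ComplexInterval :=
  ⟨fun S T => ⟨realMul S.re T.re - realMul S.im T.im, realMul S.re T.im + realMul S.im T.re⟩⟩

/-- Makes finite sums `∑ k, S k` of complex intervals available. -/
instance : AddCommMonoid ComplexInterval where
  add_assoc _ _ _ := ComplexInterval.ext (add_assoc _ _ _) (add_assoc _ _ _)
  zero_add _ := ComplexInterval.ext (zero_add _) (zero_add _)
  add_zero _ := ComplexInterval.ext (add_zero _) (add_zero _)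
  add_comm _ _ := ComplexInterval.ext (add_comm _ _) (add_comm _ _)
  nsmul := nsmulRec

end ComplexInterval

/-- `n`-dimensional boxes: `n`-fold products of complex intervals. -/
abbrev ComplexBox (n : ℕ) : Type := Fin n → ComplexInterval

/-- The points of `ℂⁿ` that lie in a box. -/
def ComplexBox.toSet {n : ℕ} (I : ComplexBox n) : Set (Fin n → ℂ) := {z | ∀ j, z j ∈ I j}

/-- The degenerate box `{z}`. -/
def ComplexBox.point {n : ℕ} (z : Fin n → ℂ) : ComplexBox n :=
  fun j => ComplexInterval.point (z j)

/-- The boxes contained in `U`. -/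
abbrev BoxesIn {n : ℕ} (U : Set (Fin n → ℂ)) : Type := {I : ComplexBox n // I.toSet ⊆ U}

/-- `n × n` matrices of complex intervals. -/
abbrev IntervalMatrix (n : ℕ) : Type := Matrix (Fin n) (Fin n) ComplexInterval

/-- The complex matrices that lie in an interval matrix. -/
def IntervalMatrix.toSet {n : ℕ} (M : IntervalMatrix n) : Set (Matrix (Fin n) (Fin n) ℂ) :=
  {A | ∀ j k, A j k ∈ M j k}

/-- The degenerate interval matrix `{A}`. -/
def IntervalMatrix.point {n : ℕ} (A : Matrix (Fin n) (Fin n) ℂ) : IntervalMatrix n :=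
  A.map ComplexInterval.point

/-- The product of an interval matrix and a box in interval arithmetic. -/
def IntervalMatrix.mulBox {n : ℕ} (M : IntervalMatrix n) (I : ComplexBox n) : ComplexBox n :=
  fun j => ∑ k, M j k * I k

/-- The operator norm of a complex matrix, for the max-norm on `ℂⁿ` (the norm of `Fin n → ℂ`). -/
def opNorm {n : ℕ} (A : Matrix (Fin n) (Fin n) ℂ) : ℝ :=
  ‖LinearMap.toContinuousLinearMap (Matrix.toLin' A)‖

/-- The maximum of the operator norms of the matrices in an interval matrix; `isGreatest_norm`
shows that the maximum is attained. -/
def IntervalMatrix.norm {n : ℕ} (M : IntervalMatrix n) : ℝ := sSup (opNorm '' M.toSet)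

theorem IntervalMatrix.isGreatest_norm {n : ℕ} (M : IntervalMatrix n) :
    IsGreatest (opNorm '' M.toSet) M.norm := by
  have hs : M.toSet = Set.univ.pi fun j => Set.univ.pi fun k =>
      (Set.Icc (M j k).re.fst (M j k).re.snd) ×ℂ (Set.Icc (M j k).im.fst (M j k).im.snd) := by
    ext A
    exact ⟨fun h j _ k _ => h j k, fun h j k => h j trivial k trivial⟩
  have hc : IsCompact M.toSet := by
    rw [hs]
    exact isCompact_univ_pi fun j => isCompact_univ_pi fun k =>
      isCompact_Icc.reProdIm isCompact_Icc
  have hne : M.toSet.Nonempty :=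
    ⟨fun j k => ⟨(M j k).re.fst, (M j k).im.fst⟩, fun j k =>
      ⟨⟨le_refl _, (M j k).re.fst_le_snd⟩, ⟨le_refl _, (M j k).im.fst_le_snd⟩⟩⟩
  have hcont : Continuous (opNorm (n := n)) := by
    have h : Continuous fun A : Matrix (Fin n) (Fin n) ℂ =>
        LinearMap.toContinuousLinearMap (Matrix.toLin' A) :=
      LinearMap.continuous_of_finiteDimensional
        (LinearMap.toContinuousLinearMap.toLinearMap ∘ₗ
          (Matrix.toLin' (R := ℂ) (m := Fin n) (n := Fin n)).toLinearMap)
    exact h.norm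
  exact (hc.image hcont).isGreatest_sSup (hne.image _)

/-- The Jacobian matrix `F'(x)`. -/
def jacobian {n : ℕ} (F : (Fin n → ℂ) → (Fin n → ℂ)) (x : Fin n → ℂ) :
    Matrix (Fin n) (Fin n) ℂ :=
  LinearMap.toMatrix' (fderiv ℂ F x : (Fin n → ℂ) →ₗ[ℂ] (Fin n → ℂ))

/-- `dF` is an interval extension on `U` of the matrix-valued function `f`: for every box `I ⊆ U`,
the interval matrix `dF I` contains `f x` for all `x ∈ I`. -/
def IsIntervalExtension {n : ℕ} {U : Set (Fin n → ℂ)}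
    (f : (Fin n → ℂ) → Matrix (Fin n) (Fin n) ℂ) (dF : BoxesIn U → IntervalMatrix n) : Prop :=
  ∀ I : BoxesIn U, f '' I.1.toSet ⊆ (dF I).toSet

/-- The interval matrix `Iₙ - Y M`. -/
def residual {n : ℕ} (Y : Matrix.GeneralLinearGroup (Fin n) ℂ) (M : IntervalMatrix n) :
    IntervalMatrix n :=
  IntervalMatrix.point 1 - IntervalMatrix.point (Y : Matrix (Fin n) (Fin n) ℂ) * M

/-- The Krawczyk operator
`K_y(I) = y - Y F(y) + (Iₙ - Y □F'(I)) (I - y)`, where `dF` is `□F'`. -/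
def krawczykOperator {n : ℕ} {U : Set (Fin n → ℂ)} (F : (Fin n → ℂ) → (Fin n → ℂ))
    (dF : BoxesIn U → IntervalMatrix n) (Y : Matrix.GeneralLinearGroup (Fin n) ℂ)
    (y : Fin n → ℂ) (I : BoxesIn U) : ComplexBox n :=
  ComplexBox.point (y - (Y : Matrix (Fin n) (Fin n) ℂ).mulVec (F y)) +
    (residual Y (dF I)).mulBox (I.1 - ComplexBox.point y)

end

end Krawczyk

/-!
The proof studies the Newton-like map `G x = x - Y F(x)`, whose fixed points are the roots of `F`
because `Y` is invertible. Its derivative at any point of `I` is a matrix in `Iₙ - Y □F'(I)`, so the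
real mean value theorem, applied to the real and imaginary parts of each coordinate separately,
writes each such part of `G x - G x'` as that of `A (x - x')` for some matrix `A` in
`Iₙ - Y □F'(I)` (`exists_mem_residual_apply_sub_eq`). Since interval arithmetic encloses pointwise
arithmetic and acts on real and imaginary parts separately, this gives `G(I) ⊆ K_y(I)`
(`newtonMap_mem_krawczykOperator`), hence the first claim. The third claim follows from the same
identity with `x` and `x'` roots: the real and the imaginary part of each coordinate of `x - x'` are
at most `‖Iₙ - Y □F'(I)‖ ‖x - x'‖`, and the factor `√2` combines them.

The second claim needs no Brouwer fixed point theorem. If `K_y(I) ⊆ I`, then for *every* matrix `A`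
in `Iₙ - Y □F'(I)` the affine map `p ↦ y - Y F(y) + A (p - y)` sends `I` into itself, so `A` maps
`I - I` into itself. Now `I - I` is the product of the symmetric intervals whose radii are the
widths of `I`, and so the mean value identity says that `G` is nonexpansive on `I` for the
(possibly degenerate) gauge of `I - I` (`newtonMap_sub_mem_widthBall`). A nonexpansive self-map of a
box has a fixed point: for `t < 1` iterating the contraction `x ↦ y + t (G x - y)` gives points
that `G` moves arbitrarily little, and compactness finishes (`exists_fixedPoint_of_nonexpansive`).
-/

namespace Krawczyk

/-! ### Interval arithmetic encloses pointwise arithmetic -/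

namespace ComplexInterval

theorem mem_iff {z : ℂ} {S : ComplexInterval} :
    z ∈ S ↔ (S.re.fst ≤ z.re ∧ z.re ≤ S.re.snd) ∧ (S.im.fst ≤ z.im ∧ z.im ≤ S.im.snd) :=
  Iff.rfl

theorem mem_point (z : ℂ) : z ∈ point z :=
  ⟨⟨le_rfl, le_rfl⟩, ⟨le_rfl, le_rfl⟩⟩

theorem add_mem {S T : ComplexInterval} {z w : ℂ} (hz : z ∈ S) (hw : w ∈ T) : z + w ∈ S + T :=
  ⟨⟨add_le_add hz.1.1 hw.1.1, add_le_add hz.1.2 hw.1.2⟩,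
    ⟨add_le_add hz.2.1 hw.2.1, add_le_add hz.2.2 hw.2.2⟩⟩

theorem sub_mem {S T : ComplexInterval} {z w : ℂ} (hz : z ∈ S) (hw : w ∈ T) : z - w ∈ S - T :=
  ⟨⟨sub_le_sub hz.1.1 hw.1.2, sub_le_sub hz.1.2 hw.1.1⟩,
    ⟨sub_le_sub hz.2.1 hw.2.2, sub_le_sub hz.2.2 hw.2.1⟩⟩

theorem mul_mem {S T : ComplexInterval} {z w : ℂ} (hz : z ∈ S) (hw : w ∈ T) : z * w ∈ S * T := by
  have h1 := mul_mem_realMul hz.1 hw.1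
  have h2 := mul_mem_realMul hz.2 hw.2
  have h3 := mul_mem_realMul hz.1 hw.2
  have h4 := mul_mem_realMul hz.2 hw.1
  exact ⟨⟨sub_le_sub h1.1 h2.2, sub_le_sub h1.2 h2.1⟩, ⟨add_le_add h3.1 h4.1, add_le_add h3.2 h4.2⟩⟩

theorem sum_mem {ι : Type*} (s : Finset ι) {S : ι → ComplexInterval} {z : ι → ℂ}
    (h : ∀ i ∈ s, z i ∈ S i) : ∑ i ∈ s, z i ∈ ∑ i ∈ s, S i := by
  classical
  induction s using Finset.induction_on with
  | empty => exact mem_point 0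
  | insert a s ha ih =>
    rw [Finset.sum_insert ha, Finset.sum_insert ha]
    exact add_mem (h a (Finset.mem_insert_self a s))
      (ih fun i hi => h i (Finset.mem_insert_of_mem hi))

end ComplexInterval

open ComplexInterval

variable {n : ℕ}

theorem IntervalMatrix.mulVec_mem_mulBox {M : IntervalMatrix n} {J : ComplexBox n}
    {A : Matrix (Fin n) (Fin n) ℂ} {v : Fin n → ℂ} (hA : A ∈ M.toSet) (hv : v ∈ J.toSet) :
    A.mulVec v ∈ (M.mulBox J).toSet := fun j =>
  ComplexInterval.sum_mem _ fun k _ => mul_mem (hA j k) (hv k)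

theorem sub_mul_mem_residual {Y : Matrix.GeneralLinearGroup (Fin n) ℂ} {M : IntervalMatrix n}
    {A : Matrix (Fin n) (Fin n) ℂ} (hA : A ∈ M.toSet) :
    1 - (Y : Matrix (Fin n) (Fin n) ℂ) * A ∈ (residual Y M).toSet := fun j k => by
  refine ComplexInterval.sub_mem (mem_point _) ?_
  rw [Matrix.mul_apply, Matrix.mul_apply]
  exact ComplexInterval.sum_mem _ fun l _ => mul_mem (mem_point _) (hA l k)

/-! ### The geometry of boxes -/

namespace ComplexBox

theorem isCompact_toSet (I : ComplexBox n) : IsCompact I.toSet := by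
  have hs : I.toSet = Set.univ.pi fun j =>
      (Set.Icc (I j).re.fst (I j).re.snd) ×ℂ (Set.Icc (I j).im.fst (I j).im.snd) := by
    ext z
    exact ⟨fun h j _ => h j, fun h j => h j trivial⟩
  rw [hs]
  exact isCompact_univ_pi fun j => isCompact_Icc.reProdIm isCompact_Icc

theorem convex_toSet (I : ComplexBox n) : Convex ℝ I.toSet := by
  intro x hx y hy a b ha hb hab j
  have h1 := convex_Icc (I j).re.fst (I j).re.snd (hx j).1 (hy j).1 ha hb hab
  have h2 := convex_Icc (I j).im.fst (I j).im.snd (hx j).2 (hy j).2 ha hb hab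
  rw [mem_iff]
  simpa using And.intro h1 h2

/-- The multiple `r (I - I)` of the difference set of a box, described by coordinates: the vectors
whose real and imaginary parts are at most `r` times the corresponding widths of `I`. For varying
`r` these are the balls of the gauge of `I - I`; the description by inequalities makes sense also
when some of the widths vanish. -/
def widthBall (I : ComplexBox n) (r : ℝ) : Set (Fin n → ℂ) :=
  {v | ∀ j, |(v j).re| ≤ r * ((I j).re.snd - (I j).re.fst) ∧
    |(v j).im| ≤ r * ((I j).im.snd - (I j).im.fst)}

variable {I : ComplexBox n}

theorem sub_mem_widthBall {x x' : Fin n → ℂ} (hx : x ∈ I.toSet) (hx' : x' ∈ I.toSet) :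
    x - x' ∈ I.widthBall 1 := by
  intro j
  obtain ⟨⟨h1, h2⟩, h3, h4⟩ := mem_iff.1 (hx j)
  obtain ⟨⟨h5, h6⟩, h7, h8⟩ := mem_iff.1 (hx' j)
  simp only [Pi.sub_apply, Complex.sub_re, Complex.sub_im, abs_le]
  exact ⟨⟨by linarith, by linarith⟩, by linarith, by linarith⟩

theorem smul_mem_widthBall {v : Fin n → ℂ} {r t : ℝ} (ht : 0 ≤ t) (hv : v ∈ I.widthBall r) :
    t • v ∈ I.widthBall (t * r) := by
  intro j
  simp only [Pi.smul_apply, Complex.smul_re, Complex.smul_im, smul_eq_mul, abs_mul,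
    abs_of_nonneg ht, mul_assoc]
  exact ⟨mul_le_mul_of_nonneg_left (hv j).1 ht, mul_le_mul_of_nonneg_left (hv j).2 ht⟩

theorem exists_sub_mul_eq {a b r u : ℝ} (hab : a ≤ b) (hr : 0 ≤ r) (hu : |u| ≤ r * (b - a)) :
    ∃ p q, (a ≤ p ∧ p ≤ b) ∧ (a ≤ q ∧ q ≤ b) ∧ u = r * (p - q) := by
  rcases hr.eq_or_lt with rfl | hr
  · refine ⟨a, a, ⟨le_rfl, hab⟩, ⟨le_rfl, hab⟩, ?_⟩
    simpa using hu
  have h : |u| / r ≤ b - a := by rw [div_le_iff₀ hr]; linarith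
  have h0 : 0 ≤ |u| / r := by positivity
  have e : r * (|u| / r) = |u| := by field_simp
  rcases le_total 0 u with hu0 | hu0
  · refine ⟨a + |u| / r, a, ⟨by linarith, by linarith⟩, ⟨le_rfl, hab⟩, ?_⟩
    rw [add_sub_cancel_left, e, abs_of_nonneg hu0]
  · refine ⟨a, a + |u| / r, ⟨le_rfl, hab⟩, ⟨by linarith, by linarith⟩, ?_⟩
    rw [sub_add_cancel_left, mul_neg, e, abs_of_nonpos hu0, neg_neg]

theorem exists_smul_sub_eq_of_mem_widthBall {v : Fin n → ℂ} {r : ℝ} (hr : 0 ≤ r)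
    (hv : v ∈ I.widthBall r) : ∃ p ∈ I.toSet, ∃ q ∈ I.toSet, v = r • (p - q) := by
  choose p q hp hq hpq using fun j => exists_sub_mul_eq (I j).re.fst_le_snd hr (hv j).1
  choose p' q' hp' hq' hpq' using fun j => exists_sub_mul_eq (I j).im.fst_le_snd hr (hv j).2
  refine ⟨fun j => ⟨p j, p' j⟩, fun j => ⟨hp j, hp' j⟩, fun j => ⟨q j, q' j⟩,
    fun j => ⟨hq j, hq' j⟩, ?_⟩
  ext j
  apply Complex.ext
  · simpa using hpq j
  · simpa using hpq' j

/-- The balls `I.widthBall r` are bounded in the max-norm, linearly in `r`. -/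
theorem exists_norm_le_of_mem_widthBall (I : ComplexBox n) :
    ∃ W : ℝ, ∀ r, 0 ≤ r → ∀ v ∈ I.widthBall r, ‖v‖ ≤ r * W := by
  have hw : ∀ j, 0 ≤ ((I j).re.snd - (I j).re.fst) + ((I j).im.snd - (I j).im.fst) := fun j =>
    add_nonneg (sub_nonneg.2 (I j).re.fst_le_snd) (sub_nonneg.2 (I j).im.fst_le_snd)
  refine ⟨∑ j, (((I j).re.snd - (I j).re.fst) + ((I j).im.snd - (I j).im.fst)),
    fun r hr v hv => ?_⟩
  refine (pi_norm_le_iff_of_nonneg (mul_nonneg hr (Finset.sum_nonneg fun j _ => hw j))).2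
    fun j => ?_
  refine (Complex.norm_le_abs_re_add_abs_im (v j)).trans
    ((add_le_add (hv j).1 (hv j).2).trans ?_)
  rw [← mul_add]
  exact mul_le_mul_of_nonneg_left
    (Finset.single_le_sum (fun j _ => hw j) (Finset.mem_univ j)) hr

/-- A continuous self-map of a box that is nonexpansive for the gauge of the difference set of the
box has a fixed point. -/
theorem exists_fixedPoint_of_nonexpansive {y : Fin n → ℂ} (hy : y ∈ I.toSet)
    {G : (Fin n → ℂ) → (Fin n → ℂ)} (hmaps : Set.MapsTo G I.toSet I.toSet)
    (hcont : ContinuousOn G I.toSet)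
    (hG : ∀ r, 0 ≤ r → ∀ x ∈ I.toSet, ∀ x' ∈ I.toSet,
      x - x' ∈ I.widthBall r → G x - G x' ∈ I.widthBall r) :
    ∃ x ∈ I.toSet, G x = x := by
  obtain ⟨W, hW⟩ := I.exists_norm_le_of_mem_widthBall
  have hW0 : 0 ≤ W := by
    have h := hW 1 zero_le_one _ (sub_mem_widthBall hy hy)
    rw [one_mul] at h
    exact (norm_nonneg _).trans h
  have happrox : ∀ t : ℝ, 0 ≤ t → t < 1 → ∀ k : ℕ,
      ∃ x ∈ I.toSet, ‖G x - x‖ ≤ t ^ k * W + (1 - t) * W := by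
    intro t ht0 ht1 k
    set H : (Fin n → ℂ) → (Fin n → ℂ) := fun x => y + t • (G x - y) with hH
    have hHmaps : Set.MapsTo H I.toSet I.toSet := fun x hx =>
      I.convex_toSet.add_smul_sub_mem hy (hmaps hx) ⟨ht0, ht1.le⟩
    have hmem : ∀ k, H^[k] y ∈ I.toSet := fun k => hHmaps.iterate k hy
    have hstep : ∀ k, H (H^[k] y) - H^[k] y ∈ I.widthBall (t ^ k) := by
      intro k
      induction k with
      | zero => simpa using sub_mem_widthBall (hHmaps hy) hy
      | succ k ih =>
        have h := smul_mem_widthBall ht0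
          (hG _ (pow_nonneg ht0 k) _ (hHmaps (hmem k)) _ (hmem k) ih)
        rw [← pow_succ'] at h
        rw [Function.iterate_succ_apply']
        convert h using 1
        simp only [hH, smul_sub]
        abel
    refine ⟨H^[k] y, hmem k, ?_⟩
    set x := H^[k] y
    have hsplit : G x - x = (H x - x) + (1 - t) • (G x - y) := by
      simp only [hH, sub_smul, one_smul]
      abel
    have h1 := hW _ (pow_nonneg ht0 k) _ (hstep k)
    have h2 := hW 1 zero_le_one _ (sub_mem_widthBall (hmaps (hmem k)) hy)
    rw [hsplit]
    refine (norm_add_le _ _).trans (add_le_add h1 ?_)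
    rw [norm_smul, Real.norm_of_nonneg (sub_nonneg.2 ht1.le)]
    exact mul_le_mul_of_nonneg_left (by simpa using h2) (sub_nonneg.2 ht1.le)
  obtain ⟨x, hx, hmin⟩ := I.isCompact_toSet.exists_isMinOn ⟨y, hy⟩
    (hcont.sub continuousOn_id).norm
  refine ⟨x, hx, ?_⟩
  rw [← sub_eq_zero, ← norm_le_zero_iff]
  -- Let `k → ∞` first and then `t → 1` in the approximate fixed point bound.
  have hlim : ∀ t : ℝ, 0 ≤ t → t < 1 → ‖G x - x‖ ≤ (1 - t) * W := by
    intro t ht0 ht1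
    have hk : Filter.Tendsto (fun k : ℕ => t ^ k * W + (1 - t) * W) Filter.atTop
        (nhds (0 * W + (1 - t) * W)) :=
      ((tendsto_pow_atTop_nhds_zero_of_lt_one ht0 ht1).mul_const W).add_const _
    rw [zero_mul, zero_add] at hk
    refine ge_of_tendsto' hk fun k => ?_
    obtain ⟨z, hz, hzk⟩ := happrox t ht0 ht1 k
    exact (hmin hz).trans hzk
  refine le_of_forall_pos_le_add fun ε hε => ?_
  have hpos : 0 < W + ε := by positivity
  have h := hlim (W / (W + ε)) (by positivity) (by rw [div_lt_one hpos]; linarith)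
  refine h.trans ?_
  have e : 1 - W / (W + ε) = ε / (W + ε) := by field_simp; ring
  rw [e, zero_add, div_mul_eq_mul_div, div_le_iff₀ hpos]
  nlinarith

end ComplexBox

/-! ### The Newton map and its mean value property -/

/-- The simplified Newton map `x ↦ x - Y F(x)`, in which the matrix `Y` stands for an approximate
inverse of the Jacobian matrix. -/
def newtonMap (F : (Fin n → ℂ) → (Fin n → ℂ)) (Y : Matrix.GeneralLinearGroup (Fin n) ℂ)
    (x : Fin n → ℂ) : Fin n → ℂ :=
  x - (Y : Matrix (Fin n) (Fin n) ℂ).mulVec (F x)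

theorem newtonMap_eq_self_iff {F : (Fin n → ℂ) → (Fin n → ℂ)}
    {Y : Matrix.GeneralLinearGroup (Fin n) ℂ} {x : Fin n → ℂ} :
    newtonMap F Y x = x ↔ F x = 0 := by
  rw [newtonMap, sub_eq_self]
  constructor
  · intro h
    have h' := congrArg ((Y⁻¹ : Matrix.GeneralLinearGroup (Fin n) ℂ) :
      Matrix (Fin n) (Fin n) ℂ).mulVec h
    rwa [Matrix.mulVec_mulVec, ← Units.val_mul, inv_mul_cancel, Units.val_one, Matrix.one_mulVec,
      Matrix.mulVec_zero] at h'
  · intro h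
    rw [h, Matrix.mulVec_zero]

theorem hasFDerivAt_newtonMap {F : (Fin n → ℂ) → (Fin n → ℂ)}
    (Y : Matrix.GeneralLinearGroup (Fin n) ℂ) {x : Fin n → ℂ} (hF : DifferentiableAt ℂ F x) :
    HasFDerivAt (newtonMap F Y) (LinearMap.toContinuousLinearMap (Matrix.toLin'
      (1 - (Y : Matrix (Fin n) (Fin n) ℂ) * jacobian F x))) x := by
  have hY := (LinearMap.toContinuousLinearMap (Matrix.toLin'
    (Y : Matrix (Fin n) (Fin n) ℂ))).hasFDerivAt.comp x hF.hasFDerivAt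
  refine ((hasFDerivAt_id x).sub hY).congr_fderiv ?_
  ext1 v
  simp [jacobian]

variable {U : Set (Fin n → ℂ)} {F : (Fin n → ℂ) → (Fin n → ℂ)}
  {dF : BoxesIn U → IntervalMatrix n} {I : BoxesIn U} {x x' y : Fin n → ℂ}

/-- The mean value theorem for a real linear functional of the Newton map. The matrix depends on the
functional `ℓ`. -/
theorem exists_mem_residual_apply_sub_eq (hU : IsOpen U) (hF : DifferentiableOn ℂ F U)
    (hdF : IsIntervalExtension (jacobian F) dF) (Y : Matrix.GeneralLinearGroup (Fin n) ℂ)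
    (ℓ : (Fin n → ℂ) →L[ℝ] ℝ) (hx : x ∈ I.1.toSet) (hx' : x' ∈ I.1.toSet) :
    ∃ A ∈ (residual Y (dF I)).toSet,
      ℓ (newtonMap F Y x - newtonMap F Y x') = ℓ (A.mulVec (x - x')) := by
  have hderiv : ∀ z ∈ I.1.toSet, HasFDerivWithinAt (fun w => ℓ (newtonMap F Y w))
      (ℓ.comp ((LinearMap.toContinuousLinearMap (Matrix.toLin'
        (1 - (Y : Matrix (Fin n) (Fin n) ℂ) * jacobian F z))).restrictScalars ℝ))
      I.1.toSet z := fun z hz =>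
    (ℓ.hasFDerivAt.comp z ((hasFDerivAt_newtonMap Y
      (hF.differentiableAt (hU.mem_nhds (I.2 hz)))).restrictScalars ℝ)).hasFDerivWithinAt
  obtain ⟨z, hz, h⟩ := domain_mvt hderiv I.1.convex_toSet hx' hx
  refine ⟨1 - (Y : Matrix (Fin n) (Fin n) ℂ) * jacobian F z, sub_mul_mem_residual
    (hdF I ⟨z, I.1.convex_toSet.segment_subset hx' hx hz, rfl⟩), ?_⟩
  rw [map_sub, h]
  rfl

theorem exists_mem_residual_re_eq (hU : IsOpen U) (hF : DifferentiableOn ℂ F U)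
    (hdF : IsIntervalExtension (jacobian F) dF) (Y : Matrix.GeneralLinearGroup (Fin n) ℂ)
    (hx : x ∈ I.1.toSet) (hx' : x' ∈ I.1.toSet) (j : Fin n) :
    ∃ A ∈ (residual Y (dF I)).toSet,
      ((newtonMap F Y x - newtonMap F Y x') j).re = (A.mulVec (x - x') j).re :=
  exists_mem_residual_apply_sub_eq hU hF hdF Y
    (Complex.reCLM.comp (ContinuousLinearMap.proj (R := ℝ) (φ := fun _ : Fin n => ℂ) j)) hx hx'

theorem exists_mem_residual_im_eq (hU : IsOpen U) (hF : DifferentiableOn ℂ F U)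
    (hdF : IsIntervalExtension (jacobian F) dF) (Y : Matrix.GeneralLinearGroup (Fin n) ℂ)
    (hx : x ∈ I.1.toSet) (hx' : x' ∈ I.1.toSet) (j : Fin n) :
    ∃ A ∈ (residual Y (dF I)).toSet,
      ((newtonMap F Y x - newtonMap F Y x') j).im = (A.mulVec (x - x') j).im :=
  exists_mem_residual_apply_sub_eq hU hF hdF Y
    (Complex.imCLM.comp (ContinuousLinearMap.proj (R := ℝ) (φ := fun _ : Fin n => ℂ) j)) hx hx'

/-! ### The Krawczyk operator -/

theorem add_mulVec_mem_krawczykOperator {Y : Matrix.GeneralLinearGroup (Fin n) ℂ}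
    {A : Matrix (Fin n) (Fin n) ℂ} (hA : A ∈ (residual Y (dF I)).toSet) (hx : x ∈ I.1.toSet)
    (y : Fin n → ℂ) :
    newtonMap F Y y + A.mulVec (x - y) ∈ (krawczykOperator F dF Y y I).toSet := fun j =>
  add_mem (mem_point _) (IntervalMatrix.mulVec_mem_mulBox hA
    (fun k => sub_mem (hx k) (mem_point (y k))) j)

theorem newtonMap_mem_krawczykOperator (hU : IsOpen U) (hF : DifferentiableOn ℂ F U)
    (hdF : IsIntervalExtension (jacobian F) dF) (Y : Matrix.GeneralLinearGroup (Fin n) ℂ)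
    (hx : x ∈ I.1.toSet) (hy : y ∈ I.1.toSet) :
    newtonMap F Y x ∈ (krawczykOperator F dF Y y I).toSet := by
  intro j
  obtain ⟨A, hA, hre⟩ := exists_mem_residual_re_eq hU hF hdF Y hx hy j
  obtain ⟨B, hB, him⟩ := exists_mem_residual_im_eq hU hF hdF Y hx hy j
  have h1 := (add_mulVec_mem_krawczykOperator (F := F) hA hx y j).1
  have h2 := (add_mulVec_mem_krawczykOperator (F := F) hB hx y j).2
  rw [Pi.add_apply, Complex.add_re, ← hre, Pi.sub_apply, Complex.sub_re, add_sub_cancel] at h1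
  rw [Pi.add_apply, Complex.add_im, ← him, Pi.sub_apply, Complex.sub_im, add_sub_cancel] at h2
  exact ⟨h1, h2⟩

/-- If `K_y(I) ⊆ I`, then every matrix in `Iₙ - Y □F'(I)` maps the balls of the gauge of `I - I` into
themselves: the points `y - Y F(y) + A (p - y)` and `y - Y F(y) + A (q - y)` lie in `I` for all
`p, q ∈ I`, and their difference is `A (p - q)`. -/
theorem mulVec_mem_widthBall {Y : Matrix.GeneralLinearGroup (Fin n) ℂ}
    (hK : (krawczykOperator F dF Y y I).toSet ⊆ I.1.toSet)
    {A : Matrix (Fin n) (Fin n) ℂ} (hA : A ∈ (residual Y (dF I)).toSet) {r : ℝ} (hr : 0 ≤ r)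
    {v : Fin n → ℂ} (hv : v ∈ I.1.widthBall r) : A.mulVec v ∈ I.1.widthBall r := by
  obtain ⟨p, hp, q, hq, rfl⟩ := ComplexBox.exists_smul_sub_eq_of_mem_widthBall hr hv
  have h := ComplexBox.smul_mem_widthBall hr (ComplexBox.sub_mem_widthBall
    (hK (add_mulVec_mem_krawczykOperator (F := F) hA hp y))
    (hK (add_mulVec_mem_krawczykOperator (F := F) hA hq y)))
  rwa [add_sub_add_left_eq_sub, ← Matrix.mulVec_sub, sub_sub_sub_cancel_right, mul_one,
    ← Matrix.mulVec_smul] at h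

/-- If `K_y(I) ⊆ I`, then the Newton map is nonexpansive on `I` for the gauge of `I - I`. -/
theorem newtonMap_sub_mem_widthBall (hU : IsOpen U) (hF : DifferentiableOn ℂ F U)
    (hdF : IsIntervalExtension (jacobian F) dF) {Y : Matrix.GeneralLinearGroup (Fin n) ℂ}
    (hK : (krawczykOperator F dF Y y I).toSet ⊆ I.1.toSet) {r : ℝ} (hr : 0 ≤ r)
    (hx : x ∈ I.1.toSet) (hx' : x' ∈ I.1.toSet) (hxx' : x - x' ∈ I.1.widthBall r) :
    newtonMap F Y x - newtonMap F Y x' ∈ I.1.widthBall r := by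
  intro j
  obtain ⟨A, hA, hre⟩ := exists_mem_residual_re_eq hU hF hdF Y hx hx' j
  obtain ⟨B, hB, him⟩ := exists_mem_residual_im_eq hU hF hdF Y hx hx' j
  rw [hre, him]
  exact ⟨(mulVec_mem_widthBall hK hA hr hxx' j).1, (mulVec_mem_widthBall hK hB hr hxx' j).2⟩

theorem IntervalMatrix.norm_mulVec_apply_le {M : IntervalMatrix n}
    {A : Matrix (Fin n) (Fin n) ℂ} (hA : A ∈ M.toSet) (v : Fin n → ℂ) (j : Fin n) :
    ‖A.mulVec v j‖ ≤ M.norm * ‖v‖ :=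
  (norm_le_pi_norm _ j).trans
    (((LinearMap.toContinuousLinearMap (Matrix.toLin' A)).le_opNorm v).trans
      (mul_le_mul_of_nonneg_right (M.isGreatest_norm.2 ⟨A, hA, rfl⟩) (norm_nonneg v)))

theorem norm_newtonMap_sub_le (hU : IsOpen U) (hF : DifferentiableOn ℂ F U)
    (hdF : IsIntervalExtension (jacobian F) dF) (Y : Matrix.GeneralLinearGroup (Fin n) ℂ)
    (hx : x ∈ I.1.toSet) (hx' : x' ∈ I.1.toSet) :
    ‖newtonMap F Y x - newtonMap F Y x'‖ ≤
      Real.sqrt 2 * (residual Y (dF I)).norm * ‖x - x'‖ := by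
  have hnorm : 0 ≤ (residual Y (dF I)).norm := by
    obtain ⟨A, -, hA⟩ := (residual Y (dF I)).isGreatest_norm.1
    rw [← hA]
    exact norm_nonneg _
  refine (pi_norm_le_iff_of_nonneg (by positivity)).2 fun j => ?_
  obtain ⟨A, hA, hre⟩ := exists_mem_residual_re_eq hU hF hdF Y hx hx' j
  obtain ⟨B, hB, him⟩ := exists_mem_residual_im_eq hU hF hdF Y hx hx' j
  rw [mul_assoc]
  refine (Complex.norm_le_sqrt_two_mul_max _).trans
    (mul_le_mul_of_nonneg_left (max_le ?_ ?_) (Real.sqrt_nonneg 2))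
  · rw [hre]
    exact (Complex.abs_re_le_norm _).trans (IntervalMatrix.norm_mulVec_apply_le hA _ j)
  · rw [him]
    exact (Complex.abs_im_le_norm _).trans (IntervalMatrix.norm_mulVec_apply_le hB _ j)

end Krawczyk

open Krawczyk in
theorem theorem2p3 {n : ℕ} (U : Set (Fin n → ℂ)) (hU : IsOpen U)
    (F : (Fin n → ℂ) → (Fin n → ℂ)) (hF : DifferentiableOn ℂ F U)
    (dF : Krawczyk.BoxesIn U → Krawczyk.IntervalMatrix n)
    (hdF : Krawczyk.IsIntervalExtension (Krawczyk.jacobian F) dF)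
    (I : Krawczyk.BoxesIn U) (y : Fin n → ℂ) (hy : y ∈ I.1.toSet)
    (Y : Matrix.GeneralLinearGroup (Fin n) ℂ) :
    (∀ x ∈ I.1.toSet, F x = 0 → x ∈ (Krawczyk.krawczykOperator F dF Y y I).toSet) ∧
    ((Krawczyk.krawczykOperator F dF Y y I).toSet ⊆ I.1.toSet → ∃ x ∈ I.1.toSet, F x = 0) ∧
    ((∃ x ∈ I.1.toSet, F x = 0) →
      Real.sqrt 2 * (Krawczyk.residual Y (dF I)).norm < 1 →
      ∃! x, x ∈ I.1.toSet ∧ F x = 0) := by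
  refine ⟨fun x hx hFx => ?_, fun hK => ?_, ?_⟩
  · have h := newtonMap_mem_krawczykOperator hU hF hdF Y hx hy
    rwa [newtonMap_eq_self_iff.2 hFx] at h
  · obtain ⟨x, hx, hfix⟩ := ComplexBox.exists_fixedPoint_of_nonexpansive hy
      (fun x hx => hK (newtonMap_mem_krawczykOperator hU hF hdF Y hx hy))
      (fun x hx => (hasFDerivAt_newtonMap Y (hF.differentiableAt
        (hU.mem_nhds (I.2 hx)))).continuousAt.continuousWithinAt)
      (fun r hr x hx x' hx' => newtonMap_sub_mem_widthBall hU hF hdF hK hr hx hx')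
    exact ⟨x, hx, newtonMap_eq_self_iff.1 hfix⟩
  · rintro ⟨x, hx, hFx⟩ hlt
    refine ⟨x, ⟨hx, hFx⟩, fun x' ⟨hx', hFx'⟩ => ?_⟩
    have h := norm_newtonMap_sub_le hU hF hdF Y hx' hx
    rw [newtonMap_eq_self_iff.2 hFx, newtonMap_eq_self_iff.2 hFx'] at h
    rw [← sub_eq_zero, ← norm_le_zero_iff]
    nlinarith [norm_nonneg (x' - x)]
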